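/- Let $\mathbf a=(a_x,a_y,a_z)\in\mathbb R^3$, let $w(\mathbf a)=\exp\big[\tfrac{i\pi}{4}\sum_{\alpha}a_\alpha\,\sigma^\alpha\otimes\sigma^\alpha\big]$ be the canonical two-qubit gate ($\alpha\in\{x,y,z\}$, $\sigma^\alpha$ the Pauli matrices), and put $u=\cos\pi a_x+\cos\pi a_y+\cos\pi a_z$ and $v=\cos\pi a_x\cos\pi a_y+\cos\pi a_x\cos\pi a_z+\cos\pi a_y\cos\pi a_z$. A bipartition of $n$ qubits into A and B is labelled by $\mathbf s\in\{\uparrow,\downarrow\}^n$, qubit $k$ being in A iff $s_k=\uparrow$. For a vector $\psi\in(\mathbb C^2)^{\otimes n}$ write $I_{\mathbf s}(\psi)=\mathrm{tr}\,\rho_A^2$ with $\rho_A=\mathrm{tr}_B|\psi\rangle\langle\psi|$, and $\Phi'(\psi)=\sum_{\mathbf s}I_{\mathbf s}(\psi)|\mathbf s\rangle\in(\mathbb R^2)^{\otimes n}$. For $i\ne j$ let $w_{i,j}(\mathbf a)$ be the gate acting on qubits $i,j$, and $U_{i,j}=w_{i,j}(\mathbf a)V_iV_j$ with $V_i,V_j$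 independent Haar-random elements of $U(2)$ acting on qubits $i$ and $j$. On the doubled space let $\chi_\uparrow=\mathrm{SWAP}$, $\chi_\downarrow=\mathbb 1$, $\chi_{\mathbf s}=\bigotimes_k\chi_{s_k}$, and let $O=\bigotimes_k O_k$ with $O_k=\begin{pmatrix}1/3&-1/6\\-1/6&1/3\end{pmatrix}$. Define the transfer matrix of the averaged gate by $$[M'_{i,j}]_{\mathbf s,\mathbf t}=\sum_{\mathbf t'}\mathrm{tr}\big[\chi_{\mathbf s}\,w_{i,j}^{\otimes2}\,\chi_{\mathbf t'}\,(w_{i,j}^\dagger)^{\otimes 2}\big]\,O_{\mathbf t',\mathbf t}.$$ Then the following hold for all $n$ and all $i\neq j$. (1) $M'_{i,j}$ acts as the identity on all sites other than $i,j$, and on sites $i,j$, in the basis $\uparrow\uparrow,\uparrow\downarrow,\downarrow\uparrow,\downarrow\downarrow$ of $s_is_j$, as $$M'=\begin{pmatrix}1&0&0&0\\h&b_+&b_-&h\\h&b_-&b_+&h\\0&0&0&1\end{pmatrix},\qquad h=\frac{3-v}{9},\quad b_\pm=\frac{3\pm6u+5v}{36}.$$ (2) The average purities of all bipartitions evolve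 linearly by $M'_{i,j}$: for every $\psi$, $\mathbb E_{V_i,V_j}\,\Phi'(U_{i,j}\psi)=M'_{i,j}\,\Phi'(\psi)$. More generally, for every finite sequence of pairs $(i_1,j_1),\dots,(i_T,j_T)$ of distinct qubits, with all one-qubit unitaries in all steps independent and Haar-random, $\mathbb E\,\Phi'(U_{i_T,j_T}\cdots U_{i_1,j_1}\psi)=M'_{i_T,j_T}\cdots M'_{i_1,j_1}\,\Phi'(\psi)$. All these averages are of integrable functions. (3) With the invertible one-site matrix $A=\begin{pmatrix}1&-1/\sqrt3\\1&1/\sqrt3\end{pmatrix}$, the matrix $A_i^{-1}A_j^{-1}M'_{i,j}A_iA_j$ acts on sites $i,j$ (in the same basis order, and as the identity on the other sites) as $$M=\begin{pmatrix}\frac{33+v}{36}&0&0&\frac{3-v}{12}\\0&u_+&u_-&0\\0&u_-&u_+&0\\\frac{3-v}{12}&0&0&\frac{1+v}{4}\end{pmatrix},\qquad u_\pm=\frac{3\pm u}{6}.$$ (4) $M$ is symmetric, and for every $\mathbf a$ the linearly independent vectors $(3,0,0,1)$, $(0,1,1,0)$, $(0,-1,1,0)$, $(-1,0,0,3)$,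 which do not depend on the gate, are eigenvectors of $M$ with eigenvalues $1$, $1$, $u/3$, $(3+5v)/18$ respectively. -/

import Mathlib

open Matrix MeasureTheory
open scoped Kronecker

noncomputable section

namespace PurityCircuit

/-! ### The compact group U(2) and its normalised Haar measure -/

/-- The group of one-qubit unitaries. -/
abbrev U2 : Type := Matrix.unitaryGroup (Fin 2) ℂ

instance : MeasurableSpace U2 := borel U2

instance : BorelSpace U2 := ⟨rfl⟩

instance : SecondCountableTopology U2 := by
  have h : SecondCountableTopology (Matrix (Fin 2) (Fin 2) ℂ) :=
    inferInstanceAs (SecondCountableTopology (Fin 2 → Fin 2 → ℂ))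
  exact TopologicalSpace.Subtype.secondCountableTopology _

instance : CompactSpace U2 := by
  have hK : IsCompact (Set.univ.pi fun _ : Fin 2 => Set.univ.pi fun _ : Fin 2 =>
      Metric.closedBall (0 : ℂ) 1) :=
    isCompact_univ_pi fun _ => isCompact_univ_pi fun _ => isCompact_closedBall _ _
  have hc : IsClosed ((Matrix.unitaryGroup (Fin 2) ℂ : Submonoid (Matrix (Fin 2) (Fin 2) ℂ)) :
      Set (Matrix (Fin 2) (Fin 2) ℂ)) := by
    have : ((Matrix.unitaryGroup (Fin 2) ℂ : Submonoid (Matrix (Fin 2) (Fin 2) ℂ)) :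
        Set (Matrix (Fin 2) (Fin 2) ℂ)) = {x | x * star x = 1} := by
      ext x
      exact Matrix.mem_unitaryGroup_iff
    rw [this]
    exact isClosed_eq (by fun_prop) continuous_const
  have hU : IsCompact ((Matrix.unitaryGroup (Fin 2) ℂ : Submonoid (Matrix (Fin 2) (Fin 2) ℂ)) :
      Set (Matrix (Fin 2) (Fin 2) ℂ)) := by
    refine IsCompact.of_isClosed_subset hK hc ?_
    intro x hx i _ j _
    simpa using entry_norm_bound_of_unitary hx i j
  exact isCompact_iff_compactSpace.mp hU

/-- The Haar probability measure on `U(2)`. -/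
def haarU2 : Measure U2 := Measure.haarMeasure ⊤

instance : IsProbabilityMeasure haarU2 :=
  ⟨by simpa [haarU2] using Measure.haarMeasure_self (K₀ := (⊤ : TopologicalSpace.PositiveCompacts U2))⟩

instance : Measure.IsHaarMeasure haarU2 :=
  inferInstanceAs (Measure.IsHaarMeasure (Measure.haarMeasure _))

/-! ### Operators on `n` two-level sites -/

/-- Labels of the product basis of `n` two-level sites.  The same type labels bipartitions:
`s k = 0` (spin up) puts qubit `k` in subsystem A, `s k = 1` (spin down) puts it in B. -/
abbrev Config (n : ℕ) : Type := Fin n → Fin 2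

/-- The one-site matrix `V` acting on site `i` (identity on all other sites). -/
def onSite {R : Type*} [Semiring R] {n : ℕ} (i : Fin n) (V : Matrix (Fin 2) (Fin 2) R) :
    Matrix (Config n) (Config n) R :=
  Matrix.of fun x y => V (x i) (y i) * if ∀ k, k ≠ i → x k = y k then 1 else 0

/-- The two-site matrix `W` acting on sites `i`, `j` in this order (identity on all others). -/
def onSites {R : Type*} [Semiring R] {n : ℕ} (i j : Fin n)
    (W : Matrix (Fin 2 × Fin 2) (Fin 2 × Fin 2) R) : Matrix (Config n) (Config n) R :=
  Matrix.of fun x y =>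
    W (x i, x j) (y i, y j) * if ∀ k, k ≠ i → k ≠ j → x k = y k then 1 else 0

/-- A `4 × 4` array read as a two-site matrix in the basis order `(0,0), (0,1), (1,0), (1,1)`. -/
def twoSite {R : Type*} (M : Matrix (Fin 4) (Fin 4) R) :
    Matrix (Fin 2 × Fin 2) (Fin 2 × Fin 2) R :=
  M.submatrix finProdFinEquiv finProdFinEquiv

/-- The Pauli matrices `σˣ, σʸ, σᶻ`. -/
def pauli : Fin 3 → Matrix (Fin 2) (Fin 2) ℂ :=
  ![!![0, 1; 1, 0], !![0, -Complex.I; Complex.I, 0], !![1, 0; 0, -1]]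

/-- The canonical two-qubit gate `w(a) = exp [i (π/4) ∑ α, a α • σ^α ⊗ σ^α]`. -/
def canonicalGate (a : Fin 3 → ℝ) : Matrix (Fin 2 × Fin 2) (Fin 2 × Fin 2) ℂ :=
  NormedSpace.exp
    ((Complex.I * (Real.pi / 4 : ℝ)) • ∑ α : Fin 3, (a α : ℂ) • (pauli α ⊗ₖ pauli α))

/-- The elementary step `U = w(a) V_i V_j` on `n` qubits: first the one-qubit unitaries
`V.1` on qubit `i` and `V.2` on qubit `j`, then the canonical gate on `(i, j)`. -/
def step {n : ℕ} (a : Fin 3 → ℝ) (i j : Fin n) (V : U2 × U2) : Matrix (Config n) (Config n) ℂ :=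
  onSites i j (canonicalGate a) *
    (onSite i (V.1 : Matrix (Fin 2) (Fin 2) ℂ) * onSite j (V.2 : Matrix (Fin 2) (Fin 2) ℂ))

/-- A circuit of `T` elementary steps on the pairs of qubits `p 0, p 1, …`, in this time order
(later steps stand further to the left in the product). -/
def circuit {n T : ℕ} (a : Fin 3 → ℝ) (p : Fin T → Fin n × Fin n) (V : Fin T → U2 × U2) :
    Matrix (Config n) (Config n) ℂ :=
  (List.ofFn fun k => step a (p k).1 (p k).2 (V k)).reverse.prod

/-! ### Purities -/

/-- The basis label that is `x` on subsystem A and `y` on subsystem B. -/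
def glue {n : ℕ} (s : Config n) (x : {k // s k = 0} → Fin 2) (y : {k // ¬ s k = 0} → Fin 2) :
    Config n :=
  fun k => if h : s k = 0 then x ⟨k, h⟩ else y ⟨k, h⟩

/-- The reduced density matrix `ρ_A = tr_B |ψ⟩⟨ψ|` for the bipartition `s`. -/
def reducedDensity {n : ℕ} (ψ : Config n → ℂ) (s : Config n) :
    Matrix ({k // s k = 0} → Fin 2) ({k // s k = 0} → Fin 2) ℂ :=
  Matrix.of fun x x' => ∑ y : {k // ¬ s k = 0} → Fin 2, ψ (glue s x y) * star (ψ (glue s x' y))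

/-- The vector `Φ'` of all purities, `Φ'(s) = I_s(ψ) = tr_A ρ_A²`. -/
def purity {n : ℕ} (ψ : Config n → ℂ) (s : Config n) : ℝ :=
  (reducedDensity ψ s ^ 2).trace.re

/-- Nothing is lost by taking the real part in `purity`. -/
theorem purity_eq_trace {n : ℕ} (ψ : Config n → ℂ) (s : Config n) :
    ((purity ψ s : ℝ) : ℂ) = (reducedDensity ψ s ^ 2).trace := by
  have hH : (reducedDensity ψ s)ᴴ = reducedDensity ψ s := by
    ext x x'
    simp [reducedDensity, Matrix.conjTranspose_apply, mul_comm]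
  have h : star ((reducedDensity ψ s ^ 2).trace) = (reducedDensity ψ s ^ 2).trace := by
    rw [← Matrix.trace_conjTranspose, Matrix.conjTranspose_pow, hH]
  exact Complex.conj_eq_iff_re.mp h

/-! ### The transfer matrix as it arises from the average -/

/-- The one-site operators on the doubled space: `χ_↑ = SWAP`, `χ_↓ = 1`. -/
def chiSite (s : Fin 2) : Matrix (Fin 2 × Fin 2) (Fin 2 × Fin 2) ℂ :=
  if s = 0 then Matrix.of fun x y => if x = (y.2, y.1) then 1 else 0 else 1

/-- `χ_s = ⨂ k, χ_{s k}` on the doubled `n`-qubit space. -/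
def chi {n : ℕ} (s : Config n) : Matrix (Config n × Config n) (Config n × Config n) ℂ :=
  Matrix.of fun x y => ∏ k, chiSite (s k) (x.1 k, x.2 k) (y.1 k, y.2 k)

/-- `W'_{s,t} = tr [χ_s W^{⊗2} χ_t (W†)^{⊗2}]`. -/
def primed {n : ℕ} (W : Matrix (Config n) (Config n) ℂ) : Matrix (Config n) (Config n) ℂ :=
  Matrix.of fun s t => (chi s * (W ⊗ₖ W) * chi t * (Wᴴ ⊗ₖ Wᴴ)).trace

/-- `O = ⨂ k, O_k` with the one-site matrix with rows `(1/3, -1/6)` and `(-1/6, 1/3)`. -/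
def haarO (n : ℕ) : Matrix (Config n) (Config n) ℂ :=
  Matrix.of fun s t => ∏ k, (!![1 / 3, -1 / 6; -1 / 6, 1 / 3] : Matrix (Fin 2) (Fin 2) ℂ) (s k) (t k)

/-- The transfer matrix `M'_{i,j} = W' O` of the two-qubit gate `G` acting on `(i, j)`. -/
def transferMatrix {n : ℕ} (i j : Fin n) (G : Matrix (Fin 2 × Fin 2) (Fin 2 × Fin 2) ℂ) :
    Matrix (Config n) (Config n) ℂ :=
  primed (onSites i j G) * haarO n

/-! ### The explicit matrices -/

def paramU (a : Fin 3 → ℝ) : ℝ :=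
  Real.cos (Real.pi * a 0) + Real.cos (Real.pi * a 1) + Real.cos (Real.pi * a 2)

def paramV (a : Fin 3 → ℝ) : ℝ :=
  Real.cos (Real.pi * a 0) * Real.cos (Real.pi * a 1) +
    Real.cos (Real.pi * a 0) * Real.cos (Real.pi * a 2) +
    Real.cos (Real.pi * a 1) * Real.cos (Real.pi * a 2)

/-- The `4 × 4` matrix `M'` in the basis `↑↑, ↑↓, ↓↑, ↓↓`. -/
def explicitM' (a : Fin 3 → ℝ) : Matrix (Fin 4) (Fin 4) ℝ :=
  let h := (3 - paramV a) / 9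
  let bp := (3 + 6 * paramU a + 5 * paramV a) / 36
  let bm := (3 - 6 * paramU a + 5 * paramV a) / 36
  !![1, 0, 0, 0;
     h, bp, bm, h;
     h, bm, bp, h;
     0, 0, 0, 1]

/-- The symmetric `4 × 4` matrix `M`. -/
def explicitM (a : Fin 3 → ℝ) : Matrix (Fin 4) (Fin 4) ℝ :=
  let up := (3 + paramU a) / 6
  let um := (3 - paramU a) / 6
  !![(33 + paramV a) / 36, 0, 0, (3 - paramV a) / 12;
     0, up, um, 0;
     0, um, up, 0;
     (3 - paramV a) / 12, 0, 0, (1 + paramV a) / 4]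

/-- The one-site matrix `A` of the similarity transformation. -/
def simA : Matrix (Fin 2) (Fin 2) ℝ :=
  !![1, -1 / √3; 1, 1 / √3]

/-- The gate-independent eigenvectors of `M`. -/
def eigvec : Fin 4 → (Fin 4 → ℝ) :=
  ![![3, 0, 0, 1], ![0, 1, 1, 0], ![0, -1, 1, 0], ![-1, 0, 0, 3]]

/-- The eigenvalues belonging to `eigvec`. -/
def eigval (a : Fin 3 → ℝ) : Fin 4 → ℝ :=
  ![1, 1, paramU a / 3, (3 + 5 * paramV a) / 18]

end PurityCircuit

end

open PurityCircuit

/-!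
The purity of a bipartition `s` is the expectation value of `χ_s` in the doubled state `ψ ⊗ ψ`
(`purity_eq_sum_chi`), so the average purity after a random gate is the expectation value in
`ψ ⊗ ψ` of the averaged operator `E[(U ⊗ U)† χ_s (U ⊗ U)]`.

Averaging over a Haar-random one-qubit unitary projects onto the commutant of `{V ⊗ V}`, which is
spanned by `SWAP` and `1` (`twirl_invariant_eq`); the coefficients come from the inverse
`O = (1/3, -1/6; -1/6, 1/3)` of the Gram matrix `G = (4, 2; 2, 4)` of these two operators
(`integral_haar_moment`).  Hence the averaged operator is again a combination of the `χ_t`, and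
its coefficients on the two sites of the gate are the entries of `W' (O ⊗ O)`
(`integral_twirl_twoChi`).

In the Bell basis the canonical gate is diagonal (`canonicalGate_eq`), and the entries of `W'` are
Laurent polynomials in the phases `exp(iπ a_α / 4)`.  Comparing them gives
`W' = M' (G ⊗ G)` (`twoPrimed_canonicalGate`).  On `n` sites everything factors into the two sites
of the gate and the rest, where the gate is trivial and `G O = 1`; this gives both the formula for
the transfer matrix (`transferMatrix_canonicalGate`) and the evolution of the purities
(`integral_twirl_chi`, `integral_purity_step`).  Circuits follow by induction on their length, since
the first gate is independent of the others and the purities enter linearly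
(`integral_purity_circuit`).  The similarity transformation is the two-site
identity `M' (A ⊗ A) = (A ⊗ A) M` (`explicitM'_mul_simA`).
-/

namespace PurityCircuit

/-! ### Haar averages over U(2) -/

/-- Left-invariant Haar probability measures are unique, so `U(2)`, being compact, is
unimodular. -/
instance : Measure.IsMulRightInvariant haarU2 := by
  refine ⟨fun g => ?_⟩
  have : IsProbabilityMeasure (Measure.map (· * g) haarU2) :=
    Measure.isProbabilityMeasure_map (measurable_mul_const g).aemeasurable
  exact Measure.isHaarMeasure_eq_of_isProbabilityMeasure _ _

theorem integrable_of_continuous_of_compactSpace {X E : Type*} [TopologicalSpace X]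
    [CompactSpace X] [MeasurableSpace X] [OpensMeasurableSpace X] [NormedAddCommGroup E]
    (μ : Measure X) [IsFiniteMeasure μ] [SecondCountableTopologyEither X E]
    {f : X → E} (hf : Continuous f) :
    Integrable f μ :=
  hf.integrable_of_hasCompactSupport (HasCompactSupport.of_compactSpace f)

theorem continuous_unitary_apply (x y : Fin 2) :
    Continuous fun V : U2 => (V : Matrix (Fin 2) (Fin 2) ℂ) x y :=
  (continuous_subtype_val : Continuous fun V : U2 => (V : Matrix (Fin 2) (Fin 2) ℂ)).matrix_elem x y

/-- The commutant of `{V ⊗ V}` is spanned by `SWAP` and `1`.  Three unitaries suffice to see this: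
`diag(1, i)`, the bit flip, and one real reflection without zero entries. -/
theorem twirl_invariant_eq (N : Matrix (Fin 2 × Fin 2) (Fin 2 × Fin 2) ℂ)
    (hN : ∀ V : U2, ((V : Matrix (Fin 2) (Fin 2) ℂ) ⊗ₖ (V : Matrix (Fin 2) (Fin 2) ℂ))ᴴ * N *
      ((V : Matrix (Fin 2) (Fin 2) ℂ) ⊗ₖ (V : Matrix (Fin 2) (Fin 2) ℂ)) = N) :
    N = N (0, 1) (1, 0) • chiSite 0 + N (0, 1) (0, 1) • chiSite 1 := by
  have hD : !![1, 0; 0, Complex.I] ∈ Matrix.unitaryGroup (Fin 2) ℂ := by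
    rw [mem_unitaryGroup_iff, star_eq_conjTranspose]
    ext i j; fin_cases i <;> fin_cases j <;> simp [mul_apply]
  have hX : !![0, 1; 1, 0] ∈ Matrix.unitaryGroup (Fin 2) ℂ := by
    rw [mem_unitaryGroup_iff, star_eq_conjTranspose]
    ext i j; fin_cases i <;> fin_cases j <;> simp [mul_apply]
  have hR : !![(3 / 5 : ℂ), 4 / 5; 4 / 5, -3 / 5] ∈ Matrix.unitaryGroup (Fin 2) ℂ := by
    rw [mem_unitaryGroup_iff, star_eq_conjTranspose]
    ext i j; fin_cases i <;> fin_cases j <;> simp [mul_apply, Complex.conj_ofNat] <;> norm_num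
  have eD := fun x y => congrFun (congrFun (hN ⟨_, hD⟩) x) y
  have eX := fun x y => congrFun (congrFun (hN ⟨_, hX⟩) x) y
  have eR := congrFun (congrFun (hN ⟨_, hR⟩) (0, 0)) (0, 0)
  simp only [mul_apply, conjTranspose_apply, kroneckerMap_apply, Fintype.sum_prod_type,
    Fin.sum_univ_two] at eD eX eR
  have hI : ∀ z : ℂ, (Complex.I * z = z ∨ -(Complex.I * z) = z ∨ -z = z) → z = 0 := by
    rintro z (h | h | h)
    · linear_combination -(1 + Complex.I) / 2 * h + z / 2 * Complex.I_sq
    · linear_combination -(1 - Complex.I) / 2 * h + z / 2 * Complex.I_sq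
    · linear_combination -h / 2
  -- the bit flip exchanges `0` and `1` in both indices
  have h1 := eX (0, 0) (0, 0)
  have h2 := eX (0, 1) (0, 1)
  have h3 := eX (0, 1) (1, 0)
  -- conjugation by `diag(1, i)` multiplies an entry joining different numbers of excitations
  -- by `±i` or `-1`, so these entries vanish
  have z1 := eD (0, 0) (0, 1)
  have z2 := eD (0, 0) (1, 0)
  have z3 := eD (0, 0) (1, 1)
  have z4 := eD (0, 1) (0, 0)
  have z5 := eD (0, 1) (1, 1)
  have z6 := eD (1, 0) (0, 0)
  have z7 := eD (1, 0) (1, 1)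
  have z8 := eD (1, 1) (0, 0)
  have z9 := eD (1, 1) (0, 1)
  have z10 := eD (1, 1) (1, 0)
  simp [mul_comm _ Complex.I] at h1 h2 h3 z1 z2 z3 z4 z5 z6 z7 z8 z9 z10 eR
  have z1 := hI _ (.inl z1)
  have z2 := hI _ (.inl z2)
  have z3 := hI _ (.inr (.inr z3))
  have z4 := hI _ (.inr (.inl z4))
  have z5 := hI _ (.inl z5)
  have z6 := hI _ (.inr (.inl z6))
  have z7 := hI _ (.inl z7)
  have z8 := hI _ (.inr (.inr z8))
  have z9 := hI _ (.inr (.inl z9))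
  have z10 := hI _ (.inr (.inl z10))
  -- the reflection links the two diagonal blocks
  have h4 : N (0, 0) (0, 0) = N (0, 1) (1, 0) + N (0, 1) (0, 1) := by
    simp only [z1, z2, z3, z4, z5, z6, z7, z8, z9, z10, h1, h2, h3] at eR
    linear_combination -(625 / 288) * eR
  ext ⟨x1, x2⟩ ⟨y1, y2⟩
  fin_cases x1 <;> fin_cases x2 <;> fin_cases y1 <;> fin_cases y2 <;>
    simp [chiSite, z1, z2, z3, z4, z5, z6, z7, z8, z9, z10, h1, h2, h3, h4]

theorem chiSite_symm (σ : Fin 2) (x y : Fin 2 × Fin 2) : chiSite σ x y = chiSite σ y x := by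
  obtain ⟨x1, x2⟩ := x
  obtain ⟨y1, y2⟩ := y
  fin_cases σ <;> fin_cases x1 <;> fin_cases x2 <;> fin_cases y1 <;> fin_cases y2 <;>
    simp [chiSite]

/-- The Gram matrix of the one-site operators `SWAP` and `1` for the trace inner product. -/
theorem sum_chiSite_mul_chiSite (σ τ : Fin 2) :
    ∑ x, ∑ y, chiSite σ x y * chiSite τ x y
      = (!![4, 2; 2, 4] : Matrix (Fin 2) (Fin 2) ℂ) σ τ := by
  fin_cases σ <;> fin_cases τ <;>
    simp [chiSite, Fintype.sum_prod_type, one_apply, Prod.ext_iff] <;> norm_num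

/-- The mixed moments of degree `(2, 2)` of a Haar-random `V ∈ U(2)`.  As a matrix in `d`, `b` they
commute with all `W ⊗ W`, so they are a combination of `SWAP` and `1`; the coefficients follow by
taking the trace against `SWAP` and `1`, which inverts the Gram matrix. -/
theorem integral_haar_moment (a c b d : Fin 2 × Fin 2) :
    ∫ V : U2, ((V : Matrix (Fin 2) (Fin 2) ℂ) ⊗ₖ (V : Matrix (Fin 2) (Fin 2) ℂ)) a b *
        star (((V : Matrix (Fin 2) (Fin 2) ℂ) ⊗ₖ (V : Matrix (Fin 2) (Fin 2) ℂ)) c d) ∂haarU2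
      = ∑ σ, ∑ τ, chiSite σ c a *
          (!![1 / 3, -1 / 6; -1 / 6, 1 / 3] : Matrix (Fin 2) (Fin 2) ℂ) σ τ * chiSite τ d b := by
  set U : U2 → Matrix (Fin 2 × Fin 2) (Fin 2 × Fin 2) ℂ := fun V =>
    (V : Matrix (Fin 2) (Fin 2) ℂ) ⊗ₖ (V : Matrix (Fin 2) (Fin 2) ℂ) with hU
  have hUmul : ∀ V W : U2, U (V * W) = U V * U W := fun V W => by
    simp only [hU, UnitaryGroup.mul_val, mul_kronecker_mul]
  have hUU : ∀ V : U2, U V * (U V)ᴴ = 1 := fun V => by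
    have h := mem_unitaryGroup_iff.mp V.2
    rw [star_eq_conjTranspose] at h
    simp only [hU, conjTranspose_kronecker, ← mul_kronecker_mul, h, one_kronecker_one]
  have hcont : ∀ x y, Continuous fun V => U V x y := fun x y =>
    (continuous_unitary_apply _ _).mul (continuous_unitary_apply _ _)
  have hint : ∀ x y z w, Integrable (fun V => U V x y * star (U V z w)) haarU2 := fun x y z w =>
    integrable_of_continuous_of_compactSpace _ ((hcont x y).mul (hcont z w).star)
  let N : Matrix (Fin 2 × Fin 2) (Fin 2 × Fin 2) ℂ :=
    Matrix.of fun d b => ∫ V : U2, U V a b * star (U V c d) ∂haarU2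
  -- a linear functional of `N` is the integral of the functional of the integrand
  have hlin : ∀ C : Fin 2 × Fin 2 → Fin 2 × Fin 2 → ℂ, ∑ d, ∑ b, C d b * N d b
      = ∫ V : U2, ∑ d, ∑ b, C d b * (U V a b * star (U V c d)) ∂haarU2 := fun C => by
    rw [integral_finsetSum _ fun d _ =>
      integrable_finsetSum _ fun b _ => (hint _ _ _ _).const_mul _]
    refine Finset.sum_congr rfl fun d _ => ?_
    rw [integral_finsetSum _ fun b _ => (hint _ _ _ _).const_mul _]
    refine Finset.sum_congr rfl fun b _ => ?_
    rw [integral_const_mul]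
    rfl
  have hinv : ∀ g : U2, (U g)ᴴ * N * U g = N := fun g => by
    ext d b
    have h := integral_mul_right_eq_self (μ := haarU2) (fun V => U V a b * star (U V c d)) g
    have e : ((U g)ᴴ * N * U g) d b = ∑ x, ∑ y, (star (U g x d) * U g y b) * N x y := by
      simp only [mul_apply, Finset.sum_mul, conjTranspose_apply]
      rw [Finset.sum_comm]
      exact Finset.sum_congr rfl fun x _ => Finset.sum_congr rfl fun y _ => by ring
    rw [e, hlin]
    refine Eq.trans (integral_congr_ae (Filter.Eventually.of_forall fun V => ?_)) h
    simp only [hUmul, mul_apply, star_sum, star_mul', Finset.sum_mul_sum]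
    rw [Finset.sum_comm]
    exact Finset.sum_congr rfl fun x _ => Finset.sum_congr rfl fun y _ => by ring
  have htr : ∀ σ, ∑ d, ∑ b, chiSite σ b d * N d b = chiSite σ a c := fun σ => by
    have hcomm : ∀ V, U V * chiSite σ * (U V)ᴴ = chiSite σ := fun V => by
      have : U V * chiSite σ = chiSite σ * U V := by
        fin_cases σ
        · ext x y
          simp only [hU, chiSite, mul_apply, kroneckerMap_apply, Fintype.sum_prod_type,
            Fin.sum_univ_two]
          obtain ⟨x1, x2⟩ := x
          obtain ⟨y1, y2⟩ := y
          fin_cases x1 <;> fin_cases x2 <;> fin_cases y1 <;> fin_cases y2 <;> simp [mul_comm]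
        · simp [chiSite]
      rw [this, Matrix.mul_assoc, hUU, Matrix.mul_one]
    rw [hlin]
    have : ∀ V, ∑ d, ∑ b, chiSite σ b d * (U V a b * star (U V c d)) = chiSite σ a c := fun V => by
      rw [← congrFun (congrFun (hcomm V) a) c]
      simp only [mul_apply, Finset.sum_mul, conjTranspose_apply]
      exact Finset.sum_congr rfl fun x _ => Finset.sum_congr rfl fun y _ => by ring
    simp only [this]
    simp
  have hN := twirl_invariant_eq N hinv
  change N d b = _
  have t0 := htr 0
  have t1 := htr 1
  have hsum : ∀ σ, ∑ d, ∑ b, chiSite σ b d *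
      (N (0, 1) (1, 0) • chiSite 0 + N (0, 1) (0, 1) • chiSite 1) d b
        = N (0, 1) (1, 0) * ∑ d, ∑ b, chiSite σ d b * chiSite 0 d b +
          N (0, 1) (0, 1) * ∑ d, ∑ b, chiSite σ d b * chiSite 1 d b := fun σ => by
    simp only [Finset.mul_sum, ← Finset.sum_add_distrib]
    refine Finset.sum_congr rfl fun x _ => Finset.sum_congr rfl fun y _ => ?_
    rw [chiSite_symm σ y x]
    simp only [Matrix.add_apply, Matrix.smul_apply, smul_eq_mul]
    ring
  rw [hN, hsum, sum_chiSite_mul_chiSite, sum_chiSite_mul_chiSite, chiSite_symm] at t0 t1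
  rw [hN]
  simp [Fin.sum_univ_two] at t0 t1 ⊢
  rw [← t0, ← t1]
  ring

/-! ### The canonical gate in the computational basis -/

theorem twoSite_apply {R : Type*} (M : Matrix (Fin 4) (Fin 4) R) (x y : Fin 2 × Fin 2) :
    twoSite M x y = M ((![![0, 1], ![2, 3]] : Fin 2 → Fin 2 → Fin 4) x.1 x.2)
      ((![![0, 1], ![2, 3]] : Fin 2 → Fin 2 → Fin 4) y.1 y.2) := by
  obtain ⟨x1, x2⟩ := x
  obtain ⟨y1, y2⟩ := y
  fin_cases x1 <;> fin_cases x2 <;> fin_cases y1 <;> fin_cases y2 <;> rfl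

theorem twoSite_diagonal {R : Type*} [Zero R] (v : Fin 4 → R) :
    twoSite (diagonal v) =
      diagonal fun k => v ((![![0, 1], ![2, 3]] : Fin 2 → Fin 2 → Fin 4) k.1 k.2) := by
  rw [twoSite, submatrix_diagonal_equiv (e := (finProdFinEquiv : Fin 2 × Fin 2 ≃ Fin 4))]
  congr 1
  ext ⟨k1, k2⟩
  fin_cases k1 <;> fin_cases k2 <;> rfl

theorem twoSite_smul {R : Type*} [Semiring R] (c : R) (M : Matrix (Fin 4) (Fin 4) R) :
    twoSite (c • M) = c • twoSite M :=
  rfl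

theorem twoSite_one {R : Type*} [Semiring R] : twoSite (1 : Matrix (Fin 4) (Fin 4) R) = 1 :=
  submatrix_one_equiv _

theorem twoSite_mul {R : Type*} [CommSemiring R] (M N : Matrix (Fin 4) (Fin 4) R) :
    twoSite M * twoSite N = twoSite (M * N) :=
  submatrix_mul_equiv M N _ _ _

/-- The shape of the canonical gate in the computational basis: it preserves the parity of the
number of excitations and commutes with the exchange of the two qubits. -/
def parityGate (A B C D : ℂ) : Matrix (Fin 2 × Fin 2) (Fin 2 × Fin 2) ℂ :=
  twoSite !![A, 0, 0, B; 0, C, D, 0; 0, D, C, 0; B, 0, 0, A]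

/-- The columns are the unnormalised Bell vectors. -/
def bellBasis : Matrix (Fin 4) (Fin 4) ℂ :=
  !![1, 0, 0, 1; 0, 1, 1, 0; 0, 1, -1, 0; 1, 0, 0, -1]

theorem bellBasis_mul_self :
    twoSite bellBasis * ((1 / 2 : ℂ) • twoSite bellBasis) = 1 := by
  rw [← twoSite_smul, twoSite_mul, ← twoSite_one]
  congr 1
  ext x y
  fin_cases x <;> fin_cases y <;> simp [bellBasis, mul_apply, Fin.sum_univ_four] <;> norm_num

theorem bellBasis_inv : (twoSite bellBasis)⁻¹ = (1 / 2 : ℂ) • twoSite bellBasis :=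
  inv_eq_right_inv bellBasis_mul_self

theorem bellBasis_mul_diagonal_mul_inv (p q r s : ℂ) :
    twoSite bellBasis * twoSite (diagonal ![p, q, r, s]) * (twoSite bellBasis)⁻¹
      = parityGate ((p + s) / 2) ((p - s) / 2) ((q + r) / 2) ((q - r) / 2) := by
  rw [bellBasis_inv, ← twoSite_smul, twoSite_mul, twoSite_mul, parityGate]
  congr 1
  ext x y
  rw [mul_apply]
  simp only [mul_diagonal, Fin.sum_univ_four]
  fin_cases x <;> fin_cases y <;> simp [bellBasis] <;> ring

/-- The Bell vectors diagonalise all three products `σ^α ⊗ σ^α`, so the eigenvalues of the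
gate are Laurent monomials in the phases `x`, `y`, `z`. -/
theorem canonicalGate_eq (a : Fin 3 → ℝ) (x y z : ℂ)
    (hx : x = Complex.exp (Complex.I * (Real.pi / 4 : ℝ) * a 0))
    (hy : y = Complex.exp (Complex.I * (Real.pi / 4 : ℝ) * a 1))
    (hz : z = Complex.exp (Complex.I * (Real.pi / 4 : ℝ) * a 2)) :
    canonicalGate a = parityGate (z * (x * y⁻¹ + x⁻¹ * y) / 2) (z * (x * y⁻¹ - x⁻¹ * y) / 2)
      (z⁻¹ * (x * y + x⁻¹ * y⁻¹) / 2) (z⁻¹ * (x * y - x⁻¹ * y⁻¹) / 2) := by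
  set c : ℂ := Complex.I * (Real.pi / 4 : ℝ) with hc
  have hunit : IsUnit (twoSite bellBasis) :=
    (isUnit_iff_isUnit_det _).mpr (isUnit_det_of_right_inverse bellBasis_mul_self)
  have hdiag : c • ∑ α : Fin 3, (a α : ℂ) • (pauli α ⊗ₖ pauli α)
      = twoSite bellBasis * twoSite (diagonal
        ![c * a 2 + (c * a 0 - c * a 1), -(c * a 2) + (c * a 0 + c * a 1),
          -(c * a 2) - (c * a 0 + c * a 1), c * a 2 - (c * a 0 - c * a 1)]) *
        (twoSite bellBasis)⁻¹ := by
    rw [bellBasis_mul_diagonal_mul_inv]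
    ext ⟨x1, x2⟩ ⟨y1, y2⟩
    fin_cases x1 <;> fin_cases x2 <;> fin_cases y1 <;> fin_cases y2 <;>
      simp [parityGate, twoSite_apply, Fin.sum_univ_three, pauli] <;> ring
  have hexp : NormedSpace.exp (twoSite (diagonal
        ![c * a 2 + (c * a 0 - c * a 1), -(c * a 2) + (c * a 0 + c * a 1),
          -(c * a 2) - (c * a 0 + c * a 1), c * a 2 - (c * a 0 - c * a 1)]))
      = twoSite (diagonal ![z * (x * y⁻¹), z⁻¹ * (x * y), z⁻¹ * (x⁻¹ * y⁻¹), z * (x⁻¹ * y)]) := by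
    rw [twoSite_diagonal, exp_diagonal, twoSite_diagonal]
    congr 1
    ext ⟨k1, k2⟩
    rw [Pi.coe_exp, ← Complex.exp_eq_exp_ℂ, hx, hy, hz]
    fin_cases k1 <;> fin_cases k2 <;>
      simp [← Complex.exp_neg, ← Complex.exp_add] <;> congr 1 <;> ring
  rw [canonicalGate, hdiag, exp_conj _ _ hunit, hexp, bellBasis_mul_diagonal_mul_inv]
  congr 1 <;> ring

/-! ### The transfer matrix of two qubits -/

/-- `χ_{τ₁} ⊗ χ_{τ₂}` on the doubled space of two qubits. -/
def twoChi (τ : Fin 2 × Fin 2) :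
    Matrix ((Fin 2 × Fin 2) × (Fin 2 × Fin 2)) ((Fin 2 × Fin 2) × (Fin 2 × Fin 2)) ℂ :=
  Matrix.of fun x y => chiSite τ.1 (x.1.1, x.2.1) (y.1.1, y.2.1) *
    chiSite τ.2 (x.1.2, x.2.2) (y.1.2, y.2.2)

/-- The permutation of the basis of the doubled space that `twoChi τ` describes. -/
def twoSwap (τ : Fin 2 × Fin 2) (x : (Fin 2 × Fin 2) × (Fin 2 × Fin 2)) :
    (Fin 2 × Fin 2) × (Fin 2 × Fin 2) :=
  ((if τ.1 = 0 then x.2.1 else x.1.1, if τ.2 = 0 then x.2.2 else x.1.2),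
   (if τ.1 = 0 then x.1.1 else x.2.1, if τ.2 = 0 then x.1.2 else x.2.2))

theorem twoChi_apply (τ : Fin 2 × Fin 2) (x y : (Fin 2 × Fin 2) × (Fin 2 × Fin 2)) :
    twoChi τ x y = if y = twoSwap τ x then 1 else 0 := by
  obtain ⟨⟨x1, x2⟩, ⟨x3, x4⟩⟩ := x
  obtain ⟨⟨y1, y2⟩, ⟨y3, y4⟩⟩ := y
  obtain ⟨τ1, τ2⟩ := τ
  have h : ∀ σ p q : Fin 2, ∀ r : Fin 2 × Fin 2, chiSite σ (p, q) r =
      if r = (if σ = 0 then q else p, if σ = 0 then p else q) then 1 else 0 := by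
    rintro σ p q ⟨r, s⟩
    fin_cases σ <;> simp [chiSite, one_apply, and_comm, eq_comm]
  simp only [twoChi, of_apply, h, twoSwap, Prod.mk.injEq, ite_mul, one_mul, zero_mul, ← ite_and]
  congr 1
  simp only [eq_iff_iff]
  tauto

/-- The two-qubit case of `primed`. -/
def twoPrimed (w : Matrix (Fin 2 × Fin 2) (Fin 2 × Fin 2) ℂ) :
    Matrix (Fin 2 × Fin 2) (Fin 2 × Fin 2) ℂ :=
  Matrix.of fun σ τ => (twoChi σ * (w ⊗ₖ w) * twoChi τ * (wᴴ ⊗ₖ wᴴ)).trace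

theorem twoPrimed_apply (w : Matrix (Fin 2 × Fin 2) (Fin 2 × Fin 2) ℂ) (σ τ : Fin 2 × Fin 2) :
    twoPrimed w σ τ = ∑ x, ∑ y, (w ⊗ₖ w) (twoSwap σ x) y * star ((w ⊗ₖ w) x (twoSwap τ y)) := by
  rw [twoPrimed, of_apply, Matrix.mul_assoc, trace]
  simp only [diag_apply, mul_apply (M := twoChi σ * _), mul_apply (M := twoChi _), twoChi_apply,
    ite_mul, one_mul, zero_mul, Finset.sum_ite_eq', Finset.mem_univ, if_true,
    ← conjTranspose_kronecker, conjTranspose_apply]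

/-- The phase `exp(iπt/4)` is nonzero, its conjugate is its inverse, and `cos πt` is the mean
of its fourth power and the fourth power of its inverse. -/
theorem quarter_phase_properties (t : ℝ) :
    Complex.exp (Complex.I * (Real.pi / 4 : ℝ) * t) ≠ 0 ∧
    starRingEnd ℂ (Complex.exp (Complex.I * (Real.pi / 4 : ℝ) * t))
      = (Complex.exp (Complex.I * (Real.pi / 4 : ℝ) * t))⁻¹ ∧
    ((Real.cos (Real.pi * t) : ℝ) : ℂ) = ((Complex.exp (Complex.I * (Real.pi / 4 : ℝ) * t)) ^ 4 +
      (Complex.exp (Complex.I * (Real.pi / 4 : ℝ) * t))⁻¹ ^ 4) / 2 := by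
  refine ⟨Complex.exp_ne_zero _, ?_, ?_⟩
  · rw [← Complex.exp_conj, ← Complex.exp_neg]
    congr 1
    simp only [map_mul, Complex.conj_I, Complex.conj_ofReal]
    ring
  · rw [← Complex.exp_neg, ← Complex.exp_nat_mul, ← Complex.exp_nat_mul, Complex.ofReal_cos,
      Complex.cos]
    push_cast
    congr 3 <;> ring

set_option maxHeartbeats 4000000 in
/-- The two-qubit identity `W' = M' (G ⊗ G)`, where `G` is the Gram matrix of `SWAP` and `1`.
Written in the phases `exp(iπ a_α / 4)`, each entry is an identity of Laurent polynomials. -/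
theorem twoPrimed_canonicalGate (a : Fin 3 → ℝ) :
    twoPrimed (canonicalGate a) = (twoSite (explicitM' a)).map (fun r : ℝ => (r : ℂ)) *
      (!![4, 2; 2, 4] ⊗ₖ !![4, 2; 2, 4]) := by
  obtain ⟨x, hx⟩ : ∃ x, x = Complex.exp (Complex.I * (Real.pi / 4 : ℝ) * a 0) := ⟨_, rfl⟩
  obtain ⟨y, hy⟩ : ∃ y, y = Complex.exp (Complex.I * (Real.pi / 4 : ℝ) * a 1) := ⟨_, rfl⟩
  obtain ⟨z, hz⟩ : ∃ z, z = Complex.exp (Complex.I * (Real.pi / 4 : ℝ) * a 2) := ⟨_, rfl⟩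
  rw [canonicalGate_eq a x y z hx hy hz]
  obtain ⟨hx0, hx1, hx2⟩ := quarter_phase_properties (a 0)
  obtain ⟨hy0, hy1, hy2⟩ := quarter_phase_properties (a 1)
  obtain ⟨hz0, hz1, hz2⟩ := quarter_phase_properties (a 2)
  rw [← hx] at hx0 hx1 hx2
  rw [← hy] at hy0 hy1 hy2
  rw [← hz] at hz0 hz1 hz2
  obtain ⟨A, hA⟩ : ∃ A, A = z * (x * y⁻¹ + x⁻¹ * y) / 2 := ⟨_, rfl⟩
  obtain ⟨B, hB⟩ : ∃ B, B = z * (x * y⁻¹ - x⁻¹ * y) / 2 := ⟨_, rfl⟩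
  obtain ⟨C, hC⟩ : ∃ C, C = z⁻¹ * (x * y + x⁻¹ * y⁻¹) / 2 := ⟨_, rfl⟩
  obtain ⟨D, hD⟩ : ∃ D, D = z⁻¹ * (x * y - x⁻¹ * y⁻¹) / 2 := ⟨_, rfl⟩
  rw [← hA, ← hB, ← hC, ← hD]
  have hA' : starRingEnd ℂ A = z⁻¹ * (x⁻¹ * y + x * y⁻¹) / 2 := by
    simp [hA, hx1, hy1, hz1, Complex.conj_ofNat]
  have hB' : starRingEnd ℂ B = z⁻¹ * (x⁻¹ * y - x * y⁻¹) / 2 := by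
    simp [hB, hx1, hy1, hz1, Complex.conj_ofNat]
  have hC' : starRingEnd ℂ C = z * (x⁻¹ * y⁻¹ + x * y) / 2 := by
    simp [hC, hx1, hy1, hz1, Complex.conj_ofNat]
  have hD' : starRingEnd ℂ D = z * (x⁻¹ * y⁻¹ - x * y) / 2 := by
    simp [hD, hx1, hy1, hz1, Complex.conj_ofNat]
  have hu : ((paramU a : ℝ) : ℂ) = (x ^ 4 + x⁻¹ ^ 4) / 2 + (y ^ 4 + y⁻¹ ^ 4) / 2 +
      (z ^ 4 + z⁻¹ ^ 4) / 2 := by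
    rw [paramU, Complex.ofReal_add, Complex.ofReal_add, hx2, hy2, hz2]
  have hv : ((paramV a : ℝ) : ℂ) = (x ^ 4 + x⁻¹ ^ 4) / 2 * ((y ^ 4 + y⁻¹ ^ 4) / 2) +
      (x ^ 4 + x⁻¹ ^ 4) / 2 * ((z ^ 4 + z⁻¹ ^ 4) / 2) +
      (y ^ 4 + y⁻¹ ^ 4) / 2 * ((z ^ 4 + z⁻¹ ^ 4) / 2) := by
    rw [paramV]
    push_cast only [Complex.ofReal_add, Complex.ofReal_mul]
    rw [hx2, hy2, hz2]
  ext ⟨σ1, σ2⟩ ⟨τ1, τ2⟩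
  rw [twoPrimed_apply, mul_apply]
  simp only [twoSwap, Fintype.sum_prod_type, Fin.sum_univ_two, kroneckerMap_apply]
  fin_cases σ1 <;> fin_cases σ2 <;> fin_cases τ1 <;> fin_cases τ2
  all_goals
    simp [parityGate, twoSite_apply, explicitM', hu, hv]
    ring_nf
    -- conjugates are replaced first, since the entries `A`, …, `D` occur inside them
    simp only [hA', hB', hC', hD']
    simp only [hA, hB, hC, hD]
    field_simp
    ring

/-! ### Splitting off two sites -/

/-- A basis label of `n` sites is a label of the sites `i`, `j` together with a label of the
remaining ones. -/
def splitSites {n : ℕ} {i j : Fin n} (hij : i ≠ j) :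
    Config n ≃ (Fin 2 × Fin 2) × ({k : Fin n // k ≠ i ∧ k ≠ j} → Fin 2) where
  toFun x := ((x i, x j), fun k => x k)
  invFun p k := if hi : k = i then p.1.1 else if hj : k = j then p.1.2 else p.2 ⟨k, hi, hj⟩
  left_inv x := by
    ext k
    by_cases hi : k = i
    · simp [hi]
    · by_cases hj : k = j
      · subst hj
        simp [hi]
      · simp [hi, hj]
  right_inv p := by
    ext k
    · simp
    · simp [hij.symm]
    · simp [k.2.1, k.2.2]

theorem splitSites_symm_left {n : ℕ} {i j : Fin n} (hij : i ≠ j) (ρ : Fin 2 × Fin 2)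
    (r : {k : Fin n // k ≠ i ∧ k ≠ j} → Fin 2) : (splitSites hij).symm (ρ, r) i = ρ.1 := by
  simp [splitSites]

theorem splitSites_symm_right {n : ℕ} {i j : Fin n} (hij : i ≠ j) (ρ : Fin 2 × Fin 2)
    (r : {k : Fin n // k ≠ i ∧ k ≠ j} → Fin 2) : (splitSites hij).symm (ρ, r) j = ρ.2 := by
  simp [splitSites, hij.symm]

theorem splitSites_symm_rest {n : ℕ} {i j : Fin n} (hij : i ≠ j) (ρ : Fin 2 × Fin 2)
    (r : {k : Fin n // k ≠ i ∧ k ≠ j} → Fin 2) (k : {k : Fin n // k ≠ i ∧ k ≠ j}) :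
    (splitSites hij).symm (ρ, r) k = r k := by
  simp [splitSites, k.2.1, k.2.2]

/-- The splitting `splitSites` of both factors of the doubled space. -/
def splitDoubled {n : ℕ} {i j : Fin n} (hij : i ≠ j) :
    Config n × Config n ≃ ((Fin 2 × Fin 2) × (Fin 2 × Fin 2)) ×
      (({k : Fin n // k ≠ i ∧ k ≠ j} → Fin 2) × ({k : Fin n // k ≠ i ∧ k ≠ j} → Fin 2)) :=
  ((splitSites hij).prodCongr (splitSites hij)).trans (Equiv.prodProdProdComm _ _ _ _)

theorem onSites_eq_submatrix {R : Type*} [CommSemiring R] {n : ℕ} {i j : Fin n} (hij : i ≠ j)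
    (W : Matrix (Fin 2 × Fin 2) (Fin 2 × Fin 2) R) :
    onSites i j W = (W ⊗ₖ (1 : Matrix ({k : Fin n // k ≠ i ∧ k ≠ j} → Fin 2)
      ({k : Fin n // k ≠ i ∧ k ≠ j} → Fin 2) R)).submatrix (splitSites hij) (splitSites hij) := by
  ext x y
  have h : (∀ k, k ≠ i → k ≠ j → x k = y k) ↔ (splitSites hij x).2 = (splitSites hij y).2 := by
    simp [splitSites, funext_iff]
  simp only [onSites, of_apply, submatrix_apply, kroneckerMap_apply, one_apply, h]
  rfl

theorem onSites_mul {R : Type*} [CommSemiring R] {n : ℕ} {i j : Fin n} (hij : i ≠ j)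
    (W W' : Matrix (Fin 2 × Fin 2) (Fin 2 × Fin 2) R) :
    onSites i j W * onSites i j W' = onSites i j (W * W') := by
  simp only [onSites_eq_submatrix hij]
  rw [submatrix_mul_equiv, ← mul_kronecker_mul, Matrix.one_mul]

theorem onSites_one {R : Type*} [CommSemiring R] {n : ℕ} {i j : Fin n} (hij : i ≠ j) :
    onSites i j (1 : Matrix (Fin 2 × Fin 2) (Fin 2 × Fin 2) R) = 1 := by
  rw [onSites_eq_submatrix hij, one_kronecker_one, submatrix_one_equiv]

theorem onSite_left_eq_onSites {R : Type*} [CommSemiring R] {n : ℕ} {i j : Fin n} (hij : i ≠ j)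
    (A : Matrix (Fin 2) (Fin 2) R) : onSite i A = onSites i j (A ⊗ₖ 1) := by
  ext x y
  simp only [onSite, onSites, of_apply, kroneckerMap_apply, one_apply, mul_assoc, ← ite_and,
    ite_mul, one_mul, zero_mul]
  congr 2
  refine propext ⟨fun h => ⟨h j hij.symm, fun k hi _ => h k hi⟩, fun h k hi => ?_⟩
  by_cases hj : k = j
  · exact hj ▸ h.1
  · exact h.2 k hi hj

theorem onSite_right_eq_onSites {R : Type*} [CommSemiring R] {n : ℕ} {i j : Fin n} (hij : i ≠ j)
    (B : Matrix (Fin 2) (Fin 2) R) : onSite j B = onSites i j (1 ⊗ₖ B) := by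
  ext x y
  simp only [onSite, onSites, of_apply, kroneckerMap_apply, one_apply, mul_comm _ (B _ _),
    mul_assoc, ← ite_and, ite_mul, one_mul, zero_mul]
  congr 2
  refine propext ⟨fun h => ⟨h i hij, fun k _ hj => h k hj⟩, fun h k hj => ?_⟩
  by_cases hi : k = i
  · exact hi ▸ h.1
  · exact h.2 k hi hj

theorem onSite_mul_onSite {R : Type*} [CommSemiring R] {n : ℕ} {i j : Fin n} (hij : i ≠ j)
    (A B : Matrix (Fin 2) (Fin 2) R) : onSite i A * onSite j B = onSites i j (A ⊗ₖ B) := by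
  rw [onSite_left_eq_onSites hij, onSite_right_eq_onSites hij, onSites_mul hij,
    ← mul_kronecker_mul, Matrix.mul_one, Matrix.one_mul]

theorem onSite_mul_onSite' {R : Type*} [CommSemiring R] {n : ℕ} {i j : Fin n} (hij : i ≠ j)
    (A B : Matrix (Fin 2) (Fin 2) R) : onSite j B * onSite i A = onSites i j (A ⊗ₖ B) := by
  rw [onSite_left_eq_onSites hij, onSite_right_eq_onSites hij, onSites_mul hij,
    ← mul_kronecker_mul, Matrix.mul_one, Matrix.one_mul]

/-- Row `s` of a two-site matrix only meets the labels that agree with `s` on the other sites. -/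
theorem sum_onSites_mul {R : Type*} [CommSemiring R] {n : ℕ} {i j : Fin n} (hij : i ≠ j)
    (W : Matrix (Fin 2 × Fin 2) (Fin 2 × Fin 2) R) (s : Config n) (f : Config n → R) :
    ∑ r, onSites i j W s r * f r
      = ∑ ρ, W (s i, s j) ρ * f ((splitSites hij).symm (ρ, fun k => s k)) := by
  rw [← (splitSites hij).symm.sum_comp, Fintype.sum_prod_type]
  refine Finset.sum_congr rfl fun ρ _ => ?_
  refine (Finset.sum_eq_single (fun k : {k : Fin n // k ≠ i ∧ k ≠ j} => s k) ?_ ?_).trans ?_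
  · intro r _ hr
    have : (splitSites hij s).2 ≠ r := fun h => hr (by rw [← h]; rfl)
    simp [onSites_eq_submatrix hij, one_apply, this]
  · simp
  · simp only [onSites_eq_submatrix hij, submatrix_apply, Equiv.apply_symm_apply,
      kroneckerMap_apply]
    congr 1
    exact (congrArg _ (one_apply_eq _)).trans (mul_one _)

theorem onSites_map_ofReal {n : ℕ} (i j : Fin n) (W : Matrix (Fin 2 × Fin 2) (Fin 2 × Fin 2) ℝ) :
    (onSites i j W).map (fun r : ℝ => (r : ℂ)) = onSites i j (W.map fun r : ℝ => (r : ℂ)) := by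
  ext s t
  simp only [onSites, map_apply, of_apply]
  split_ifs <;> simp

/-- A product over all sites, with the factors of `i` and `j` split off. -/
theorem prod_split {M : Type*} [CommMonoid M] {n : ℕ} {i j : Fin n} (hij : i ≠ j)
    (f : Fin n → M) :
    ∏ k, f k = f i * f j * ∏ k : {k : Fin n // k ≠ i ∧ k ≠ j}, f k := by
  rw [← Finset.mul_prod_erase _ f (Finset.mem_univ i),
    ← Finset.mul_prod_erase _ f (Finset.mem_erase.mpr ⟨hij.symm, Finset.mem_univ j⟩), mul_assoc]
  congr 2
  exact Finset.prod_subtype _ (by simp [and_comm]) f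

/-- `⨂ k, χ_{s k}` on the doubled space of the sites `k : ι`. -/
def siteChi {ι : Type*} [Fintype ι] (s : ι → Fin 2) :
    Matrix ((ι → Fin 2) × (ι → Fin 2)) ((ι → Fin 2) × (ι → Fin 2)) ℂ :=
  Matrix.of fun x y => ∏ k, chiSite (s k) (x.1 k, x.2 k) (y.1 k, y.2 k)

theorem chi_eq_submatrix {n : ℕ} {i j : Fin n} (hij : i ≠ j) (s : Config n) :
    chi s = (twoChi (s i, s j) ⊗ₖ
      siteChi fun k : {k : Fin n // k ≠ i ∧ k ≠ j} => s k).submatrix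
        (splitDoubled hij) (splitDoubled hij) := by
  ext x y
  rw [chi, of_apply, prod_split hij]
  rfl

theorem onSites_kronecker_onSites {n : ℕ} {i j : Fin n} (hij : i ≠ j)
    (W : Matrix (Fin 2 × Fin 2) (Fin 2 × Fin 2) ℂ) :
    onSites i j W ⊗ₖ onSites i j W = ((W ⊗ₖ W) ⊗ₖ (1 : Matrix
      (({k : Fin n // k ≠ i ∧ k ≠ j} → Fin 2) × ({k : Fin n // k ≠ i ∧ k ≠ j} → Fin 2))
      (({k : Fin n // k ≠ i ∧ k ≠ j} → Fin 2) × ({k : Fin n // k ≠ i ∧ k ≠ j} → Fin 2)) ℂ)).submatrix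
        (splitDoubled hij) (splitDoubled hij) := by
  ext x y
  rw [onSites_eq_submatrix hij, ← one_kronecker_one]
  simp only [kroneckerMap_apply, submatrix_apply]
  exact mul_mul_mul_comm _ _ _ _

/-! ### The transfer matrix -/

/-- The Gram matrix of the operators `χ_s` is a tensor power. -/
theorem trace_siteChi_mul_siteChi {ι : Type*} [Fintype ι] [DecidableEq ι] (s t : ι → Fin 2) :
    (siteChi s * siteChi t).trace
      = ∏ k, (!![4, 2; 2, 4] : Matrix (Fin 2) (Fin 2) ℂ) (s k) (t k) := by
  -- both sides are sums over one label of the fourfold product basis for each site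
  simp only [← sum_chiSite_mul_chiSite, ← Fintype.sum_prod_type']
  rw [Fintype.prod_sum, trace]
  simp only [diag_apply, mul_apply, siteChi, of_apply, ← Fintype.sum_prod_type',
    ← Finset.prod_mul_distrib]
  let f : ((ι → Fin 2) × (ι → Fin 2)) × ((ι → Fin 2) × (ι → Fin 2)) ≃
      (ι → (Fin 2 × Fin 2) × (Fin 2 × Fin 2)) :=
    ((Equiv.arrowProdEquivProdArrow _ _ _).symm.prodCongr
      (Equiv.arrowProdEquivProdArrow _ _ _).symm).trans (Equiv.arrowProdEquivProdArrow _ _ _).symm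
  rw [← f.sum_comp]
  refine Finset.sum_congr rfl fun x _ => Finset.prod_congr rfl fun k _ => ?_
  rw [chiSite_symm (t k)]
  rfl

theorem trace_submatrix_equiv {l m R : Type*} [Fintype l] [Fintype m] [AddCommMonoid R]
    (e : l ≃ m) (A : Matrix m m R) : (A.submatrix e e).trace = A.trace :=
  e.sum_comp (diag A)

/-- Outside of `i`, `j` the gate acts trivially, so the trace defining `primed` factors into the
two-site trace and the Gram matrix of the remaining `χ`s. -/
theorem primed_onSites {n : ℕ} {i j : Fin n} (hij : i ≠ j)
    (W : Matrix (Fin 2 × Fin 2) (Fin 2 × Fin 2) ℂ) (s t : Config n) :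
    primed (onSites i j W) s t = twoPrimed W (s i, s j) (t i, t j) *
      ∏ k : {k : Fin n // k ≠ i ∧ k ≠ j},
        (!![4, 2; 2, 4] : Matrix (Fin 2) (Fin 2) ℂ) (s k) (t k) := by
  rw [← trace_siteChi_mul_siteChi, primed, of_apply, twoPrimed, of_apply,
    ← conjTranspose_kronecker, ← conjTranspose_kronecker, onSites_kronecker_onSites hij,
    chi_eq_submatrix hij, chi_eq_submatrix hij, conjTranspose_submatrix,
    conjTranspose_kronecker _ (1 : Matrix _ _ ℂ), conjTranspose_one]
  simp only [submatrix_mul_equiv, ← mul_kronecker_mul, Matrix.mul_one]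
  rw [← trace_kronecker, trace_submatrix_equiv]

theorem prod_matrix_mul {ι R : Type*} [Fintype ι] [DecidableEq ι] [CommSemiring R]
    (A B : Matrix (Fin 2) (Fin 2) R) :
    (Matrix.of fun s t : ι → Fin 2 => ∏ k, A (s k) (t k)) *
      (Matrix.of fun s t : ι → Fin 2 => ∏ k, B (s k) (t k))
      = Matrix.of fun s t : ι → Fin 2 => ∏ k, (A * B) (s k) (t k) := by
  ext s t
  simp only [mul_apply, of_apply, ← Finset.prod_mul_distrib]
  rw [← Fintype.prod_sum fun k c => A (s k) c * B c (t k)]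

theorem siteGram_mul_siteO :
    (!![4, 2; 2, 4] : Matrix (Fin 2) (Fin 2) ℂ) * !![1 / 3, -1 / 6; -1 / 6, 1 / 3] = 1 := by
  ext x y
  fin_cases x <;> fin_cases y <;> simp [mul_apply] <;> norm_num

/-- `haarO` is the inverse Gram matrix of the operators `χ_s`. -/
theorem gram_mul_haarO (n : ℕ) :
    (Matrix.of fun s t : Config n =>
      ∏ k, (!![4, 2; 2, 4] : Matrix (Fin 2) (Fin 2) ℂ) (s k) (t k)) * haarO n = 1 := by
  rw [haarO, prod_matrix_mul, siteGram_mul_siteO]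
  ext s t
  simp only [of_apply, one_apply]
  rw [Finset.prod_ite_zero]
  simp [funext_iff]

theorem transferMatrix_canonicalGate (a : Fin 3 → ℝ) {n : ℕ} {i j : Fin n} (hij : i ≠ j) :
    transferMatrix i j (canonicalGate a)
      = (onSites i j (twoSite (explicitM' a))).map (fun r : ℝ => (r : ℂ)) := by
  rw [onSites_map_ofReal, transferMatrix]
  suffices h : primed (onSites i j (canonicalGate a))
      = onSites i j ((twoSite (explicitM' a)).map fun r : ℝ => (r : ℂ)) *
        Matrix.of fun s t : Config n =>
          ∏ k, (!![4, 2; 2, 4] : Matrix (Fin 2) (Fin 2) ℂ) (s k) (t k) by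
    rw [h, Matrix.mul_assoc, gram_mul_haarO, Matrix.mul_one]
  ext s t
  rw [primed_onSites hij, twoPrimed_canonicalGate, mul_apply, mul_apply, sum_onSites_mul hij,
    Finset.sum_mul]
  refine Finset.sum_congr rfl fun ρ _ => ?_
  rw [of_apply, prod_split hij, mul_assoc]
  congr 1
  generalize (!![4, 2; 2, 4] : Matrix (Fin 2) (Fin 2) ℂ) = G
  rw [splitSites_symm_left, splitSites_symm_right]
  simp only [splitSites_symm_rest]
  rfl

/-! ### Purities as expectation values in the doubled state -/

/-- The purity is the expectation value of `χ_s` in `ψ ⊗ ψ`. -/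
theorem purity_eq_sum_chi {n : ℕ} (ψ : Config n → ℂ) (s : Config n) :
    ((purity ψ s : ℝ) : ℂ)
      = ∑ x, ∑ y, star (ψ x.1 * ψ x.2) * chi s x y * (ψ y.1 * ψ y.2) := by
  have hchi : ∀ x y, chi s x y = if x = ((fun k => if s k = 0 then y.2 k else y.1 k),
      (fun k => if s k = 0 then y.1 k else y.2 k)) then 1 else 0 := fun x y => by
    have h : ∀ k, chiSite (s k) (x.1 k, x.2 k) (y.1 k, y.2 k)
        = if x.1 k = (if s k = 0 then y.2 k else y.1 k) ∧
            x.2 k = (if s k = 0 then y.1 k else y.2 k) then 1 else 0 := fun k => by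
      by_cases hk : s k = 0 <;> simp [chiSite, hk, one_apply]
    simp only [chi, of_apply, h]
    rw [Finset.prod_ite_zero]
    simp [Prod.ext_iff, funext_iff, forall_and]
  rw [purity_eq_trace, Finset.sum_comm]
  simp only [hchi, mul_ite, ite_mul, mul_one, mul_zero, zero_mul, Finset.sum_ite_eq',
    Finset.mem_univ, if_true]
  let e := (Equiv.piEquivPiSubtypeProd (fun k => s k = 0) (fun _ : Fin n => Fin 2)).symm
  rw [← (e.prodCongr e).sum_comp]
  simp only [Fintype.sum_prod_type, pow_two, trace, diag_apply, mul_apply, reducedDensity,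
    of_apply, Finset.sum_mul_sum]
  refine Finset.sum_congr rfl fun x _ => ?_
  -- a pair of basis labels is a pair of labels on A and a pair on B; `χ_s` exchanges the A parts
  have hmix : ∀ (p q : {k // s k = 0} → Fin 2) (r u : {k // ¬ s k = 0} → Fin 2),
      (fun k => if s k = 0 then glue s q u k else glue s p r k) = glue s q r := fun p q r u => by
    ext k
    by_cases hk : s k = 0 <;> simp [glue, hk]
  have he : ∀ p q r u, e.prodCongr e ((p, q), (r, u)) = (glue s p q, glue s r u) :=
    fun _ _ _ _ => rfl
  rw [Finset.sum_comm]
  refine Finset.sum_congr rfl fun y _ => Finset.sum_congr rfl fun x' _ =>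
    Finset.sum_congr rfl fun y' _ => ?_
  rw [he, hmix, hmix, star_mul']
  ring

/-! ### Averaging one gate -/

theorem twoChi_symm (τ : Fin 2 × Fin 2) (x y : (Fin 2 × Fin 2) × (Fin 2 × Fin 2)) :
    twoChi τ x y = twoChi τ y x := by
  simp only [twoChi, of_apply]
  rw [chiSite_symm τ.1, chiSite_symm τ.2]

/-- The two-copy operator `(w (V₁ ⊗ V₂))^{⊗2}` of a two-qubit gate `w` preceded by one-qubit
unitaries.  With `w = 1` it is the two-copy operator of the one-qubit unitaries alone. -/
def doubledGate (w : Matrix (Fin 2 × Fin 2) (Fin 2 × Fin 2) ℂ) (V : U2 × U2) :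
    Matrix ((Fin 2 × Fin 2) × (Fin 2 × Fin 2)) ((Fin 2 × Fin 2) × (Fin 2 × Fin 2)) ℂ :=
  (w * ((V.1 : Matrix (Fin 2) (Fin 2) ℂ) ⊗ₖ (V.2 : Matrix (Fin 2) (Fin 2) ℂ))) ⊗ₖ
    (w * ((V.1 : Matrix (Fin 2) (Fin 2) ℂ) ⊗ₖ (V.2 : Matrix (Fin 2) (Fin 2) ℂ)))

/-- The fourth mixed moments of `V₁ ⊗ V₂`: by independence they are products of one-qubit
moments. -/
theorem integral_local_moment (a c b d : (Fin 2 × Fin 2) × (Fin 2 × Fin 2)) :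
    ∫ V : U2 × U2, doubledGate 1 V a b * star (doubledGate 1 V c d) ∂(haarU2.prod haarU2)
      = ∑ σ, ∑ τ, twoChi σ c a *
        ((!![1 / 3, -1 / 6; -1 / 6, 1 / 3] : Matrix (Fin 2) (Fin 2) ℂ) ⊗ₖ
          !![1 / 3, -1 / 6; -1 / 6, 1 / 3]) σ τ * twoChi τ d b := by
  have h : ∀ V : U2 × U2, doubledGate 1 V a b * star (doubledGate 1 V c d)
      = (((V.1 : Matrix (Fin 2) (Fin 2) ℂ) ⊗ₖ (V.1 : Matrix (Fin 2) (Fin 2) ℂ))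
          (a.1.1, a.2.1) (b.1.1, b.2.1) *
        star (((V.1 : Matrix (Fin 2) (Fin 2) ℂ) ⊗ₖ (V.1 : Matrix (Fin 2) (Fin 2) ℂ))
          (c.1.1, c.2.1) (d.1.1, d.2.1))) *
        (((V.2 : Matrix (Fin 2) (Fin 2) ℂ) ⊗ₖ (V.2 : Matrix (Fin 2) (Fin 2) ℂ))
          (a.1.2, a.2.2) (b.1.2, b.2.2) *
        star (((V.2 : Matrix (Fin 2) (Fin 2) ℂ) ⊗ₖ (V.2 : Matrix (Fin 2) (Fin 2) ℂ))
          (c.1.2, c.2.2) (d.1.2, d.2.2))) := fun V => by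
    simp only [doubledGate, Matrix.one_mul, kroneckerMap_apply, star_mul']
    ring
  simp only [h]
  rw [integral_prod_mul (fun V : U2 => ((V : Matrix (Fin 2) (Fin 2) ℂ) ⊗ₖ
      (V : Matrix (Fin 2) (Fin 2) ℂ)) (a.1.1, a.2.1) (b.1.1, b.2.1) *
      star (((V : Matrix (Fin 2) (Fin 2) ℂ) ⊗ₖ (V : Matrix (Fin 2) (Fin 2) ℂ))
        (c.1.1, c.2.1) (d.1.1, d.2.1))) (fun V : U2 => ((V : Matrix (Fin 2) (Fin 2) ℂ) ⊗ₖ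
      (V : Matrix (Fin 2) (Fin 2) ℂ)) (a.1.2, a.2.2) (b.1.2, b.2.2) *
      star (((V : Matrix (Fin 2) (Fin 2) ℂ) ⊗ₖ (V : Matrix (Fin 2) (Fin 2) ℂ))
        (c.1.2, c.2.2) (d.1.2, d.2.2))), integral_haar_moment, integral_haar_moment,
    Finset.sum_mul_sum, Fintype.sum_prod_type]
  refine Finset.sum_congr rfl fun σ₁ _ => Finset.sum_congr rfl fun σ₂ _ => ?_
  rw [Finset.sum_mul_sum, Fintype.sum_prod_type]
  refine Finset.sum_congr rfl fun τ₁ _ => Finset.sum_congr rfl fun τ₂ _ => ?_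
  simp only [twoChi, of_apply, kroneckerMap_apply]
  ring

theorem doubledGate_eq (w : Matrix (Fin 2 × Fin 2) (Fin 2 × Fin 2) ℂ) (V : U2 × U2) :
    doubledGate w V = (w ⊗ₖ w) * doubledGate 1 V := by
  simp only [doubledGate, Matrix.one_mul, mul_kronecker_mul]

theorem continuous_doubledGate (w : Matrix (Fin 2 × Fin 2) (Fin 2 × Fin 2) ℂ) :
    Continuous (doubledGate w) := by
  have h : Continuous (doubledGate 1) := by
    refine continuous_matrix fun x y => ?_
    simp only [doubledGate, Matrix.one_mul, kroneckerMap_apply]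
    exact ((((continuous_unitary_apply _ _).comp continuous_fst).mul
      ((continuous_unitary_apply _ _).comp continuous_snd))).mul
      (((continuous_unitary_apply _ _).comp continuous_fst).mul
      ((continuous_unitary_apply _ _).comp continuous_snd))
  rw [show doubledGate w = fun V => (w ⊗ₖ w) * doubledGate 1 V from funext (doubledGate_eq w)]
  exact continuous_const.matrix_mul h

theorem sum_comm_pairs {α β γ δ M : Type*} [Fintype α] [Fintype β] [Fintype γ] [Fintype δ]
    [AddCommMonoid M] (f : α → β → γ → δ → M) :
    ∑ a, ∑ b, ∑ c, ∑ d, f a b c d = ∑ c, ∑ d, ∑ a, ∑ b, f a b c d := by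
  calc ∑ a, ∑ b, ∑ c, ∑ d, f a b c d = ∑ a, ∑ c, ∑ b, ∑ d, f a b c d :=
        Finset.sum_congr rfl fun _ _ => Finset.sum_comm
    _ = ∑ c, ∑ a, ∑ b, ∑ d, f a b c d := Finset.sum_comm
    _ = ∑ c, ∑ a, ∑ d, ∑ b, f a b c d :=
        Finset.sum_congr rfl fun _ _ => Finset.sum_congr rfl fun _ _ => Finset.sum_comm
    _ = ∑ c, ∑ d, ∑ a, ∑ b, f a b c d := Finset.sum_congr rfl fun _ _ => Finset.sum_comm

/-- Averaging `χ_σ` over the random gate gives a combination of the `χ_τ`, with coefficients the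
row `σ` of `W' O`. -/
theorem integral_twirl_twoChi (w : Matrix (Fin 2 × Fin 2) (Fin 2 × Fin 2) ℂ) (σ : Fin 2 × Fin 2)
    (d b : (Fin 2 × Fin 2) × (Fin 2 × Fin 2)) :
    ∫ V : U2 × U2, ((doubledGate w V)ᴴ * twoChi σ * doubledGate w V) d b ∂(haarU2.prod haarU2)
      = ∑ τ, (twoPrimed w * ((!![1 / 3, -1 / 6; -1 / 6, 1 / 3] : Matrix (Fin 2) (Fin 2) ℂ) ⊗ₖ
          (!![1 / 3, -1 / 6; -1 / 6, 1 / 3] : Matrix (Fin 2) (Fin 2) ℂ)) :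
            Matrix (Fin 2 × Fin 2) (Fin 2 × Fin 2) ℂ) σ τ * twoChi τ d b := by
  -- in `X` the fixed gate is absorbed, so only moments of `V₁ ⊗ V₂` are left to average
  set X := (w ⊗ₖ w)ᴴ * twoChi σ * (w ⊗ₖ w) with hX
  have hexp : ∀ V, ((doubledGate w V)ᴴ * twoChi σ * doubledGate w V) d b
      = ∑ a, ∑ c, X c a * (doubledGate 1 V a b * star (doubledGate 1 V c d)) := fun V => by
    have : (doubledGate w V)ᴴ * twoChi σ * doubledGate w V
        = (doubledGate 1 V)ᴴ * X * doubledGate 1 V := by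
      rw [doubledGate_eq, conjTranspose_mul, hX]
      simp only [Matrix.mul_assoc]
    rw [this]
    simp only [mul_apply (N := doubledGate 1 V), mul_apply (N := X), Finset.sum_mul,
      conjTranspose_apply]
    exact Finset.sum_congr rfl fun a _ => Finset.sum_congr rfl fun c _ => by ring
  have hcont : ∀ a b, Continuous fun V => doubledGate 1 V a b := fun a b =>
    (continuous_doubledGate 1).matrix_elem a b
  have hint : ∀ a c, Integrable (fun V => X c a *
      (doubledGate 1 V a b * star (doubledGate 1 V c d))) (haarU2.prod haarU2) := fun a c =>
    (integrable_of_continuous_of_compactSpace _ ((hcont a b).mul (hcont c d).star)).const_mul _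
  have htr : ∀ σ', ∑ a, ∑ c, X c a * twoChi σ' c a = twoPrimed w σ σ' := fun σ' => by
    have : twoPrimed w σ σ' = (X * twoChi σ').trace := by
      rw [twoPrimed, of_apply, ← conjTranspose_kronecker, trace_mul_comm, hX]
      simp only [Matrix.mul_assoc]
    rw [this, trace, Finset.sum_comm]
    simp only [diag_apply, mul_apply]
    exact Finset.sum_congr rfl fun c _ => Finset.sum_congr rfl fun a _ => by rw [twoChi_symm]
  simp only [hexp]
  rw [integral_finsetSum _ fun a _ => integrable_finsetSum _ fun c _ => hint a c]
  simp only [integral_finsetSum _ fun c _ => hint _ c, integral_const_mul, integral_local_moment]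
  simp only [mul_apply (M := twoPrimed w), ← htr, Finset.sum_mul, Finset.mul_sum]
  rw [sum_comm_pairs, Finset.sum_comm]
  exact Finset.sum_congr rfl fun τ _ => Finset.sum_congr rfl fun σ' _ =>
    Finset.sum_congr rfl fun a _ => Finset.sum_congr rfl fun c _ => by ring

theorem step_eq_onSites {n : ℕ} (a : Fin 3 → ℝ) {i j : Fin n} (hij : i ≠ j) (V : U2 × U2) :
    step a i j V = onSites i j (canonicalGate a *
      ((V.1 : Matrix (Fin 2) (Fin 2) ℂ) ⊗ₖ (V.2 : Matrix (Fin 2) (Fin 2) ℂ))) := by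
  rw [step, onSite_mul_onSite hij, onSites_mul hij]

/-- The average of `χ_s` over one step in the Heisenberg picture is `∑ t, M'_{s,t} χ_t`. -/
theorem integral_twirl_chi {n : ℕ} (a : Fin 3 → ℝ) {i j : Fin n} (hij : i ≠ j) (s : Config n)
    (x y : Config n × Config n) :
    ∫ V : U2 × U2, ((step a i j V ⊗ₖ step a i j V)ᴴ * chi s *
        (step a i j V ⊗ₖ step a i j V)) x y ∂(haarU2.prod haarU2)
      = ∑ t, ((onSites i j (twoSite (explicitM' a)) s t : ℝ) : ℂ) * chi t x y := by
  have hV : ∀ V : U2 × U2, ((step a i j V ⊗ₖ step a i j V)ᴴ * chi s *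
      (step a i j V ⊗ₖ step a i j V)) x y
      = ((doubledGate (canonicalGate a) V)ᴴ * twoChi (s i, s j) *
          doubledGate (canonicalGate a) V) (splitDoubled hij x).1 (splitDoubled hij y).1 *
        siteChi (fun k : {k : Fin n // k ≠ i ∧ k ≠ j} => s k)
          (splitDoubled hij x).2 (splitDoubled hij y).2 := fun V => by
    rw [step_eq_onSites a hij, onSites_kronecker_onSites hij, chi_eq_submatrix hij,
      conjTranspose_submatrix, conjTranspose_kronecker _ (1 : Matrix _ _ ℂ), conjTranspose_one]
    simp only [submatrix_mul_equiv, ← mul_kronecker_mul, Matrix.mul_one, Matrix.one_mul]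
    rfl
  simp only [hV]
  rw [integral_mul_const, integral_twirl_twoChi, twoPrimed_canonicalGate, Matrix.mul_assoc,
    ← mul_kronecker_mul, siteGram_mul_siteO, one_kronecker_one, Matrix.mul_one]
  have := sum_onSites_mul hij ((twoSite (explicitM' a)).map fun r : ℝ => (r : ℂ)) s
    fun t => chi t x y
  rw [← onSites_map_ofReal] at this
  simp only [map_apply] at this
  rw [this, Finset.sum_mul]
  refine Finset.sum_congr rfl fun ρ _ => ?_
  rw [chi_eq_submatrix hij, splitSites_symm_left, splitSites_symm_right, mul_assoc]
  simp only [splitSites_symm_rest]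
  rfl

/-- The purity after applying `S`, in the Heisenberg picture: the evolved operator
`(S ⊗ S)† χ_s (S ⊗ S)` is paired with the fixed state `ψ ⊗ ψ`. -/
theorem purity_mulVec_eq_sum {n : ℕ} (S : Matrix (Config n) (Config n) ℂ) (ψ : Config n → ℂ)
    (s : Config n) :
    ((purity (S *ᵥ ψ) s : ℝ) : ℂ) = ∑ x, ∑ y, star (ψ x.1 * ψ x.2) * (ψ y.1 * ψ y.2) *
      ((S ⊗ₖ S)ᴴ * chi s * (S ⊗ₖ S)) x y := by
  have hd : ∀ z : Config n × Config n, (S *ᵥ ψ) z.1 * (S *ᵥ ψ) z.2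
      = ((S ⊗ₖ S) *ᵥ fun y : Config n × Config n => ψ y.1 * ψ y.2) z := fun z => by
    simp only [mulVec, dotProduct, kroneckerMap_apply, Finset.sum_mul_sum, Fintype.sum_prod_type]
    exact Finset.sum_congr rfl fun x _ => Finset.sum_congr rfl fun y _ => by ring
  generalize S ⊗ₖ S = K at *
  have h1 : ∀ (φ : Config n × Config n → ℂ)
      (A : Matrix (Config n × Config n) (Config n × Config n) ℂ),
      ∑ x, ∑ y, star (φ x) * A x y * φ y = star φ ⬝ᵥ A *ᵥ φ := fun φ A => by
    simp only [dotProduct, mulVec, Finset.mul_sum, Pi.star_apply, mul_assoc]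
  rw [purity_eq_sum_chi]
  simp only [hd]
  rw [h1, star_mulVec, ← dotProduct_mulVec, mulVec_mulVec, mulVec_mulVec]
  refine (h1 (fun y => ψ y.1 * ψ y.2) _).symm.trans ?_
  exact Finset.sum_congr rfl fun x _ => Finset.sum_congr rfl fun y _ => by ring

theorem continuous_onSite {n : ℕ} (i : Fin n) :
    Continuous fun V : U2 => onSite i (V : Matrix (Fin 2) (Fin 2) ℂ) :=
  continuous_matrix fun _ _ => (continuous_unitary_apply _ _).mul continuous_const

theorem continuous_step {n : ℕ} (a : Fin 3 → ℝ) (i j : Fin n) : Continuous (step a i j) :=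
  continuous_const.matrix_mul (((continuous_onSite i).comp continuous_fst).matrix_mul
    ((continuous_onSite j).comp continuous_snd))

theorem continuous_purity {n : ℕ} (s : Config n) : Continuous fun ψ => purity ψ s := by
  have h : Continuous fun ψ : Config n → ℂ => reducedDensity ψ s :=
    continuous_matrix fun _ _ => continuous_finsetSum _ fun _ _ =>
      (continuous_apply _).mul (continuous_apply _).star
  exact Complex.continuous_re.comp (h.pow 2).matrix_trace

theorem continuous_purity_step {n : ℕ} (a : Fin 3 → ℝ) (i j : Fin n) (ψ : Config n → ℂ)
    (s : Config n) : Continuous fun V => purity (step a i j V *ᵥ ψ) s :=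
  (continuous_purity s).comp ((continuous_step a i j).matrix_mulVec continuous_const)

theorem integral_purity_step {n : ℕ} (a : Fin 3 → ℝ) {i j : Fin n} (hij : i ≠ j)
    (ψ : Config n → ℂ) (s : Config n) :
    ∫ V : U2 × U2, purity (step a i j V *ᵥ ψ) s ∂(haarU2.prod haarU2)
      = (onSites i j (twoSite (explicitM' a)) *ᵥ purity ψ) s := by
  apply Complex.ofReal_injective
  rw [← integral_complex_ofReal]
  have hk : Continuous fun V => step a i j V ⊗ₖ step a i j V :=
    continuous_matrix fun _ _ => ((continuous_step a i j).matrix_elem _ _).mul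
      ((continuous_step a i j).matrix_elem _ _)
  have hint : ∀ x y, Integrable (fun V => star (ψ x.1 * ψ x.2) * (ψ y.1 * ψ y.2) *
      ((step a i j V ⊗ₖ step a i j V)ᴴ * chi s * (step a i j V ⊗ₖ step a i j V)) x y)
      (haarU2.prod haarU2) := fun x y =>
    (integrable_of_continuous_of_compactSpace _
      (((hk.matrix_conjTranspose.matrix_mul continuous_const).matrix_mul hk).matrix_elem
        x y)).const_mul _
  simp only [purity_mulVec_eq_sum]
  rw [integral_finsetSum _ fun x _ => integrable_finsetSum _ fun y _ => hint x y]
  simp only [integral_finsetSum _ fun y _ => hint _ y, integral_const_mul,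
    integral_twirl_chi a hij]
  simp only [mulVec, dotProduct, Complex.ofReal_sum, Complex.ofReal_mul, purity_eq_sum_chi,
    Finset.mul_sum]
  refine (Finset.sum_congr rfl fun x _ => Finset.sum_comm).trans (Finset.sum_comm.trans ?_)
  exact Finset.sum_congr rfl fun t _ => Finset.sum_congr rfl fun x _ =>
    Finset.sum_congr rfl fun y _ => by ring

/-! ### Circuits -/

theorem circuit_succ {n T : ℕ} (a : Fin 3 → ℝ) (p : Fin (T + 1) → Fin n × Fin n)
    (V : Fin (T + 1) → U2 × U2) :
    circuit a p V = circuit a (fun k => p k.succ) (fun k => V k.succ) *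
        step a (p 0).1 (p 0).2 (V 0) := by
  simp [circuit, List.ofFn_succ]

theorem continuous_circuit {n T : ℕ} (a : Fin 3 → ℝ) (p : Fin T → Fin n × Fin n) :
    Continuous (circuit a p) := by
  induction T with
  | zero =>
    rw [show circuit a p = fun _ => 1 from funext fun V => by simp [circuit]]
    exact continuous_const
  | succ T ih =>
    rw [show circuit a p = _ from funext (circuit_succ a p)]
    exact ((ih _).comp (by fun_prop)).matrix_mul ((continuous_step a _ _).comp (by fun_prop))

theorem integrable_purity_circuit {n T : ℕ} (a : Fin 3 → ℝ) (p : Fin T → Fin n × Fin n)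
    (ψ : Config n → ℂ) (s : Config n) :
    Integrable (fun V : Fin T → U2 × U2 => purity (circuit a p V *ᵥ ψ) s)
      (Measure.pi fun _ => haarU2.prod haarU2) :=
  integrable_of_continuous_of_compactSpace _
    ((continuous_purity s).comp ((continuous_circuit a p).matrix_mulVec continuous_const))

theorem integral_purity_circuit {n T : ℕ} (a : Fin 3 → ℝ) (p : Fin T → Fin n × Fin n)
    (hp : ∀ k, (p k).1 ≠ (p k).2) (ψ : Config n → ℂ) (s : Config n) :
    ∫ V : Fin T → U2 × U2, purity (circuit a p V *ᵥ ψ) s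
        ∂(Measure.pi fun _ => haarU2.prod haarU2)
      = ((List.ofFn fun k => onSites (p k).1 (p k).2 (twoSite (explicitM' a))).reverse.prod
          *ᵥ purity ψ) s := by
  induction T generalizing ψ with
  | zero => simp [circuit]
  | succ T ih =>
    -- the first gate is split off, so the induction hypothesis applies to its output state
    have hmp := measurePreserving_piFinSuccAbove (fun _ : Fin (T + 1) => haarU2.prod haarU2) 0
    have hint := (hmp.symm.integrable_comp_emb (MeasurableEquiv.measurableEmbedding _)).mpr
      (integrable_purity_circuit a p ψ s)
    rw [← hmp.symm.integral_comp (MeasurableEquiv.measurableEmbedding _)]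
    refine (integral_prod _ hint).trans ?_
    have h : ∀ (V₀ : U2 × U2) (V : Fin T → U2 × U2),
        circuit a p ((MeasurableEquiv.piFinSuccAbove (fun _ => U2 × U2) 0).symm (V₀, V)) *ᵥ ψ
          = circuit a (fun k => p k.succ) V *ᵥ (step a (p 0).1 (p 0).2 V₀ *ᵥ ψ) := fun V₀ V => by
      rw [circuit_succ, mulVec_mulVec]
      rfl
    simp only [Function.comp_apply, h, ih (fun k => p k.succ) fun k => hp k.succ]
    rw [List.ofFn_succ, List.reverse_cons, List.prod_append, List.prod_singleton, ← mulVec_mulVec]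
    generalize (List.ofFn fun k => onSites (p (Fin.succ k)).1 (p (Fin.succ k)).2
      (twoSite (explicitM' a))).reverse.prod = P
    change ∫ V, ∑ t, P s t * purity (step a (p 0).1 (p 0).2 V *ᵥ ψ) t ∂_
      = ∑ t, P s t * (onSites (p 0).1 (p 0).2 (twoSite (explicitM' a)) *ᵥ purity ψ) t
    rw [integral_finsetSum _ fun t _ => (integrable_of_continuous_of_compactSpace _
      (continuous_purity_step a _ _ ψ t)).const_mul _]
    simp only [integral_const_mul, integral_purity_step a (hp 0)]

/-! ### The similarity transformation and the spectrum -/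

theorem isUnit_of_mul_eq_one_matrix {m R : Type*} [Fintype m] [DecidableEq m] [CommRing R]
    {A B : Matrix m m R} (h : A * B = 1) : IsUnit A :=
  (isUnit_iff_isUnit_det A).mpr (isUnit_det_of_right_inverse h)

theorem isUnit_simA : IsUnit simA := by
  rw [isUnit_iff_isUnit_det, isUnit_iff_ne_zero, simA, det_fin_two_of]
  have : (0 : ℝ) < 1 / √3 := by positivity
  intro h
  rw [neg_div] at h
  linarith

theorem isUnit_onSite_left {n : ℕ} {i j : Fin n} (hij : i ≠ j) : IsUnit (onSite i simA) := by
  obtain ⟨u, hu⟩ := isUnit_simA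
  refine isUnit_of_mul_eq_one_matrix (B := onSite i (↑u⁻¹ : Matrix (Fin 2) (Fin 2) ℝ)) ?_
  rw [onSite_left_eq_onSites hij, onSite_left_eq_onSites hij, onSites_mul hij,
    ← mul_kronecker_mul, ← hu, Units.mul_inv, Matrix.one_mul, one_kronecker_one, onSites_one hij]

/-- The intertwining relation `M' (A ⊗ A) = (A ⊗ A) M`. -/
theorem explicitM'_mul_simA (a : Fin 3 → ℝ) :
    twoSite (explicitM' a) * (simA ⊗ₖ simA) = (simA ⊗ₖ simA) * twoSite (explicitM a) := by
  obtain ⟨r, hr⟩ : ∃ r, r = 1 / √3 := ⟨_, rfl⟩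
  have hr2 : r * r = 1 / 3 := by
    rw [hr, div_mul_div_comm, Real.mul_self_sqrt (by norm_num)]
    norm_num
  have hA : simA = !![1, -r; 1, r] := by rw [simA, neg_div, ← hr]
  rw [hA]
  ext ⟨x1, x2⟩ ⟨y1, y2⟩
  fin_cases x1 <;> fin_cases x2 <;> fin_cases y1 <;> fin_cases y2 <;>
    simp [twoSite_apply, explicitM', explicitM, mul_apply, Fintype.sum_prod_type, hr2] <;> ring

theorem similarity_onSites (a : Fin 3 → ℝ) {n : ℕ} {i j : Fin n} (hij : i ≠ j) :
    (onSite i simA)⁻¹ * (onSite j simA)⁻¹ * onSites i j (twoSite (explicitM' a))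
        * onSite i simA * onSite j simA = onSites i j (twoSite (explicitM a)) := by
  have hi := (isUnit_iff_isUnit_det _).mp (isUnit_onSite_left hij)
  have hj := (isUnit_iff_isUnit_det _).mp (isUnit_onSite_left hij.symm)
  have h : onSites i j (twoSite (explicitM' a)) * (onSite i simA * onSite j simA)
      = onSite j simA * (onSite i simA * onSites i j (twoSite (explicitM a))) := by
    rw [onSite_mul_onSite hij, onSites_mul hij, explicitM'_mul_simA, ← onSites_mul hij,
      ← Matrix.mul_assoc, onSite_mul_onSite' hij]
  rw [Matrix.mul_assoc, Matrix.mul_assoc _ (onSites i j _), h, Matrix.mul_assoc,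
    nonsing_inv_mul_cancel_left _ _ hj, nonsing_inv_mul_cancel_left _ _ hi]

theorem explicitM_isSymm (a : Fin 3 → ℝ) : (explicitM a).IsSymm := by
  ext x y
  fin_cases x <;> fin_cases y <;> rfl

theorem hasEigenvector_explicitM (a : Fin 3 → ℝ) (k : Fin 4) :
    Module.End.HasEigenvector (Matrix.toLin' (explicitM a)) (eigval a k) (eigvec k) := by
  refine ⟨Module.End.mem_eigenspace_iff.mpr ?_, fun h => ?_⟩
  · ext x
    rw [toLin'_apply, mulVec, dotProduct, Fin.sum_univ_four]
    fin_cases k <;> fin_cases x <;> simp [explicitM, eigvec, eigval] <;> ring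
  · have h1 := congrFun h 1
    have h3 := congrFun h 3
    fin_cases k <;> simp [eigvec] at h1 h3

theorem linearIndependent_eigvec : LinearIndependent ℝ eigvec := by
  rw [Fintype.linearIndependent_iff]
  intro g hg
  have h0 := congrFun hg 0
  have h1 := congrFun hg 1
  have h2 := congrFun hg 2
  have h3 := congrFun hg 3
  simp [eigvec, Fin.sum_univ_four] at h0 h1 h2 h3
  intro k
  fin_cases k <;> simp <;> linarith

end PurityCircuit
theorem mainTheorem4 (a : Fin 3 → ℝ) :
    -- one gate on an arbitrary pair of distinct qubits
    (∀ (n : ℕ) (i j : Fin n), i ≠ j →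
      -- the transfer matrix of the averaged gate is the explicit one
      transferMatrix i j (canonicalGate a)
          = (onSites i j (twoSite (explicitM' a))).map (fun r : ℝ => (r : ℂ)) ∧
      -- the average purities of all bipartitions evolve by it
      (∀ (ψ : Config n → ℂ) (s : Config n),
        Integrable (fun V : U2 × U2 => purity (step a i j V *ᵥ ψ) s) (haarU2.prod haarU2) ∧
        ∫ V : U2 × U2, purity (step a i j V *ᵥ ψ) s ∂(haarU2.prod haarU2)
          = (onSites i j (twoSite (explicitM' a)) *ᵥ purity ψ) s) ∧
      -- the similarity transformation
      IsUnit (onSite i simA) ∧ IsUnit (onSite j simA) ∧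
      (onSite i simA)⁻¹ * (onSite j simA)⁻¹ * onSites i j (twoSite (explicitM' a))
          * onSite i simA * onSite j simA
        = onSites i j (twoSite (explicitM a))) ∧
    -- circuits of arbitrarily many gates with independent one-qubit unitaries
    (∀ (n T : ℕ) (p : Fin T → Fin n × Fin n), (∀ k, (p k).1 ≠ (p k).2) →
      ∀ (ψ : Config n → ℂ) (s : Config n),
        Integrable (fun V : Fin T → U2 × U2 => purity (circuit a p V *ᵥ ψ) s)
          (Measure.pi fun _ => haarU2.prod haarU2) ∧
        ∫ V : Fin T → U2 × U2, purity (circuit a p V *ᵥ ψ) s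
            ∂(Measure.pi fun _ => haarU2.prod haarU2)
          = ((List.ofFn fun k => onSites (p k).1 (p k).2 (twoSite (explicitM' a))).reverse.prod
              *ᵥ purity ψ) s) ∧
    -- symmetry and the gate-independent eigenbasis
    (explicitM a).IsSymm ∧
    (∀ k : Fin 4, Module.End.HasEigenvector (Matrix.toLin' (explicitM a)) (eigval a k) (eigvec k)) ∧
    LinearIndependent ℝ eigvec := by
  exact ⟨fun _ i j hij => ⟨transferMatrix_canonicalGate a hij, fun ψ s =>
      ⟨integrable_of_continuous_of_compactSpace _ (continuous_purity_step a i j ψ s),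
        integral_purity_step a hij ψ s⟩,
      isUnit_onSite_left hij, isUnit_onSite_left hij.symm, similarity_onSites a hij⟩,
    fun _ _ p hp ψ s => ⟨integrable_purity_circuit a p ψ s, integral_purity_circuit a p hp ψ s⟩,
    explicitM_isSymm a, hasEigenvector_explicitM a, linearIndependent_eigvec⟩
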